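/- Fix $N,m\in\mathbb N$, a real $N\times N$ matrix $A$ all of whose complex eigenvalues $\lambda_1,\dots,\lambda_N$ (listed with algebraic multiplicity) satisfy $|\lambda_i|\ge 1$, and a real $N\times m$ matrix $B$. Consider the linear system $$x_{t+1}=Ax_t+Bu_t+w_t,\qquad t\ge 0,$$ where $(w_t)_{t\ge0}$ is an i.i.d. $\mathbb R^N$-valued noise process, independent of $x_0$, and where the law of $x_0$ is absolutely continuous with respect to Lebesgue measure, with density $p$ and with differential entropy $h(x_0)=-\int p\log_2 p\,dx$ well defined in $[-\infty,\infty]$ and $h(x_0)<\infty$. The system is controlled over a channel with feedback that has a finite input alphabet $\mathcal M$ and a finite output alphabet $\mathcal M'$ and is given by conditional laws $P(q'_t\mid q_{[0,t]},q'_{[0,t-1]})$, $t\ge0$. An admissible (causal) coding and control policy consists of measurable functions $\gamma^e_t$ and functions $\gamma_t$ such that the channel input is $q_t=\gamma^e_t(x_{[0,t]},q'_{[0,t-1]})\in\mathcal M$ and the control is $u_t=\gamma_t(q'_{[0,t]})\in\mathbb R^m$. The channel is assumed to be of Class A, that is: (a) for all $t\ge0$ and $b\in\mathcal M'$, almost surely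 $P(q'_t=b\mid q_{[0,t]},q'_{[0,t-1]},x_0,(w_s)_{s\ge0})=P(q'_t=b\mid q_{[0,t]},q'_{[0,t-1]})$; (b) its capacity with feedback is given by the (existing) finite limit $$C=\lim_{T\to\infty}\ \max_{\{P(q_t\mid q_{[0,t-1]},q'_{[0,t-1]}),\,0\le t\le T-1\}}\ \frac1T\sum_{t=0}^{T-1} I\big(q_{[0,t]};q'_t\mid q'_{[0,t-1]}\big),$$ where $I$ is conditional mutual information in bits (for $t=0$ the term is $I(q_0;q'_0)$). Call the state process asymptotically mean stationary (AMS) if its law $P$ on $(\mathbb R^N)^{\mathbb Z_{\ge0}}$ (with the product Borel $\sigma$-field and the shift $\theta(x_0,x_1,\dots)=(x_1,x_2,\dots)$) admits a probability measure $\bar P$ with $\lim_{n\to\infty}\frac1n\sum_{k=0}^{n-1}P(\theta^{-k}F)=\bar P(F)$ for every measurable set $F$. If, under some admissible coding and control policy, the state process $(x_t)_{t\ge0}$ is AMS, then $$C\ \ge\ \sum_{i=1}^{N}\log_2|\lambda_i| .$$ -/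

import Mathlib

open MeasureTheory ProbabilityTheory Filter Topology

/-! ### Entropy and conditional mutual information of finite random variables (base 2)

`p` is a probability mass function on a finite set `S`, and random variables are functions on `S`. -/

section FiniteInformation

variable {S X Y Z : Type*} [Fintype S] [Fintype X] [Fintype Y] [Fintype Z]

open Classical in
/-- The probability `P(U = e)` under the mass function `p`. -/
noncomputable def pmfProb {E : Type*} (p : S → ℝ) (U : S → E) (e : E) : ℝ :=
  ∑ s with U s = e, p s

/-- Conditional entropy `H(U | V) = - ∑ P(U = a, V = b) log₂ P(U = a | V = b)`. -/
noncomputable def condEntropy (p : S → ℝ) (U : S → X) (V : S → Y) : ℝ :=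
  -∑ a : X, ∑ b : Y, pmfProb p (fun s => (U s, V s)) (a, b) *
    Real.logb 2 (pmfProb p (fun s => (U s, V s)) (a, b) / pmfProb p V b)

/-- Conditional mutual information `I(U ; V | W) = H(U | W) - H(U | V, W)`. -/
noncomputable def condMutualInfo (p : S → ℝ) (U : S → X) (V : S → Y) (W : S → Z) : ℝ :=
  condEntropy p U W - condEntropy p U (fun s => (V s, W s))

end FiniteInformation

/-! ### Channels with feedback, directed information and capacity -/

/-- A finite-alphabet channel, with memory: the law of the output `q'_t` on `M'` given the inputs
`q_0, …, q_t` and the past outputs `q'_0, …, q'_{t-1}`. -/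
abbrev Channel (M M' : Type*) [Fintype M'] : Type _ :=
  (t : ℕ) → (Fin (t + 1) → M) → (Fin t → M') → stdSimplex ℝ M'

/-- A (randomized) channel-input policy with feedback: the law of `q_t` given
`q_0, …, q_{t-1}` and `q'_0, …, q'_{t-1}`. -/
abbrev InputPolicy (M M' : Type*) [Fintype M] : Type _ :=
  (t : ℕ) → (Fin t → M) → (Fin t → M') → stdSimplex ℝ M

section Capacity

variable {M M' : Type*} [Fintype M] [Fintype M']

/-- The joint mass function of `(q_{[0,T-1]}, q'_{[0,T-1]})` when the input policy `P` is used over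
the channel `Q`. -/
noncomputable def jointPMF (P : InputPolicy M M') (Q : Channel M M') (T : ℕ)
    (z : (Fin T → M) × (Fin T → M')) : ℝ :=
  ∏ t : Fin T,
    (P t (Fin.take t t.isLt.le z.1) (Fin.take t t.isLt.le z.2)).1 (z.1 t) *
      (Q t (Fin.take (t + 1) t.isLt z.1) (Fin.take t t.isLt.le z.2)).1 (z.2 t)

/-- The directed information
`I(q_{[0,T-1]} → q'_{[0,T-1]}) = ∑_{t < T} I(q'_t ; q_{[0,t]} | q'_{[0,t-1]})`
(in the term `t = 0` the conditioning is on the empty tuple, which is no conditioning). -/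
noncomputable def directedInfo (P : InputPolicy M M') (Q : Channel M M') (T : ℕ) : ℝ :=
  ∑ t : Fin T,
    condMutualInfo (jointPMF P Q T)
      (fun z => z.2 t)
      (fun z => Fin.take (t + 1) t.isLt z.1)
      (fun z => Fin.take t t.isLt.le z.2)

/-- `C` is the feedback capacity of the channel `Q`, in bits per channel use:
`C = lim_{T → ∞} max_P (1 / T) I(q_{[0,T-1]} → q'_{[0,T-1]})`, the limit being part of the claim.
(The maximum always exists: the policies form a compact space.) -/
def HasFeedbackCapacity (Q : Channel M M') (C : ℝ) : Prop :=
  ∃ R : ℕ → ℝ,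
    (∀ T : ℕ, IsGreatest (Set.range fun P : InputPolicy M M' => (1 / (T : ℝ)) * directedInfo P Q T)
      (R T)) ∧
    Tendsto R atTop (𝓝 C)

end Capacity

/-! ### Differential entropy -/

section DiffEntropy

variable {N : ℕ}

/-- The density of `μ` with respect to Lebesgue measure. -/
noncomputable def lebDensity (μ : Measure (Fin N → ℝ)) (x : Fin N → ℝ) : ℝ :=
  (μ.rnDeriv volume x).toReal

/-- The integral of the positive part of `-p log₂ p`, where `p` is the density of `μ`. -/
noncomputable def diffEntropyPos (μ : Measure (Fin N → ℝ)) : ENNReal :=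
  ∫⁻ x, ENNReal.ofReal (-(lebDensity μ x * Real.logb 2 (lebDensity μ x)))

/-- The integral of the negative part of `-p log₂ p`, where `p` is the density of `μ`. -/
noncomputable def diffEntropyNeg (μ : Measure (Fin N → ℝ)) : ENNReal :=
  ∫⁻ x, ENNReal.ofReal (lebDensity μ x * Real.logb 2 (lebDensity μ x))

/-- The differential entropy of `μ` is defined: `μ` is absolutely continuous and the integral of
`-p log₂ p` exists in `[-∞, ∞]`. -/
def HasDiffEntropy (μ : Measure (Fin N → ℝ)) : Prop :=
  μ ≪ volume ∧ (diffEntropyPos μ ≠ ⊤ ∨ diffEntropyNeg μ ≠ ⊤)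

/-- The differential entropy `h = -∫ p log₂ p`, in `[-∞, ∞]` (meaningful under `HasDiffEntropy`). -/
noncomputable def diffEntropy (μ : Measure (Fin N → ℝ)) : EReal :=
  (diffEntropyPos μ : EReal) - (diffEntropyNeg μ : EReal)

end DiffEntropy

/-! ### Asymptotic mean stationarity -/

/-- The shift `(x_0, x_1, …) ↦ (x_1, x_2, …)`. -/
def seqShift {X : Type*} (z : ℕ → X) : ℕ → X := fun n => z (n + 1)

/-- A process measure `P` on the one-sided sequence space is asymptotically mean stationary. -/
def IsAMS {X : Type*} [MeasurableSpace X] (P : Measure (ℕ → X)) : Prop :=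
  ∃ Pbar : Measure (ℕ → X), IsProbabilityMeasure Pbar ∧
    ∀ F : Set (ℕ → X), MeasurableSet F →
      Tendsto (fun n : ℕ => (1 / (n : ℝ)) * ∑ k ∈ Finset.range n, P.real (seqShift^[k] ⁻¹' F))
        atTop (𝓝 (Pbar.real F))

/-! ### The controlled system -/

/-- The history `y_0, …, y_{n-1}` of a process. -/
def hist {Ω S : Type*} (y : ℕ → Ω → S) (n : ℕ) (ω : Ω) : Fin n → S := fun i => y i ω

/-- An admissible (causal) coding and control policy: measurable encoders
`q_t = γᵉ_t(x_{[0,t]}, q'_{[0,t-1]})` and controllers `u_t = γ_t(q'_{[0,t]})`. -/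
structure AdmissiblePolicy (N m : ℕ) (M M' : Type*) [MeasurableSpace M] [MeasurableSpace M'] where
  enc : (t : ℕ) → (Fin (t + 1) → Fin N → ℝ) → (Fin t → M') → M
  measurable_enc : ∀ t, Measurable
    (fun z : (Fin (t + 1) → Fin N → ℝ) × (Fin t → M') => enc t z.1 z.2)
  ctrl : (t : ℕ) → (Fin (t + 1) → M') → (Fin m → ℝ)

section ClosedLoop

open scoped Matrix

variable {Ω M M' : Type*} [MeasurableSpace M] [MeasurableSpace M']

/-- The information `σ(q_{[0,t]}, q'_{[0,t-1]})`. -/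
abbrev channelInfo (q : ℕ → Ω → M) (q' : ℕ → Ω → M') (t : ℕ) : MeasurableSpace Ω :=
  MeasurableSpace.comap (fun ω => (hist q (t + 1) ω, hist q' t ω)) inferInstance

/-- The information `σ(q_{[0,t]}, q'_{[0,t-1]}, x_0, w_s : s ≥ 0)`. -/
abbrev channelSourceInfo {N : ℕ} (q : ℕ → Ω → M) (q' : ℕ → Ω → M')
    (x₀ : Ω → Fin N → ℝ) (w : ℕ → Ω → Fin N → ℝ) (t : ℕ) : MeasurableSpace Ω :=
  MeasurableSpace.comap
    (fun ω => (hist q (t + 1) ω, hist q' t ω, x₀ ω, fun s : ℕ => w s ω)) inferInstance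

/-- On the probability space `(Ω, μ)`, the processes `x, w, u, q, q'` are those of the linear system
`x_{t+1} = A x_t + B u_t + w_t`, with i.i.d. noise `w_t ∼ ν` independent of `x_0`, controlled over
the channel `Q` with feedback under the admissible policy `pol`. The last field is the Markov chain
condition `q'_t ↔ (q_{[0,t]}, q'_{[0,t-1]}) ↔ (x_0, w_s : s ≥ 0)` of Class A channels. -/
structure IsClosedLoop [MeasurableSpace Ω] [Fintype M'] {N m : ℕ}
    (μ : Measure Ω) (A : Matrix (Fin N) (Fin N) ℝ) (B : Matrix (Fin N) (Fin m) ℝ)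
    (ν : Measure (Fin N → ℝ)) (Q : Channel M M') (pol : AdmissiblePolicy N m M M')
    (x w : ℕ → Ω → Fin N → ℝ) (u : ℕ → Ω → Fin m → ℝ) (q : ℕ → Ω → M) (q' : ℕ → Ω → M') :
    Prop where
  measurable_init : Measurable (x 0)
  measurable_noise : ∀ t, Measurable (w t)
  measurable_output : ∀ t, Measurable (q' t)
  noise_law : ∀ t, μ.map (w t) = ν
  noise_indep : iIndepFun w μ
  init_indep : IndepFun (x 0) (fun ω => fun t : ℕ => w t ω) μ
  dynamics : ∀ t ω, x (t + 1) ω = A *ᵥ x t ω + B *ᵥ u t ω + w t ω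
  encoder : ∀ t ω, q t ω = pol.enc t (hist x (t + 1) ω) (hist q' t ω)
  controller : ∀ t ω, u t ω = pol.ctrl t (hist q' (t + 1) ω)
  channel_law : ∀ t b, μ⟦q' t ⁻¹' {b} | channelInfo q q' t⟧ =ᵐ[μ]
    fun ω => (Q t (hist q (t + 1) ω) (hist q' t ω)).1 b
  classA_markov : ∀ t b, μ⟦q' t ⁻¹' {b} | channelSourceInfo q q' (x 0) w t⟧ =ᵐ[μ]
    μ⟦q' t ⁻¹' {b} | channelInfo q q' t⟧

end ClosedLoop

/-! Freeze the outputs `q'_0, …, q'_{T-1}`: then `x_T = A^T x_0 + d`, where `d` depends only on the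
noise and on these outputs. Hence, under the law of the source alone, `x_T` lies in a bounded set
`K` while the density of `x_0` is at most `L` with probability at most `L vol(K) / |det A|^T`
(`measureReal_statePath_le`). In the closed loop, however, asymptotic mean stationarity puts `x_T`
in a suitable `K` with probability close to one for infinitely many `T` (`IsAMS.exists_frequently`).
The outputs can only achieve this by carrying information about the source.

To measure that information, compare the joint law of source and outputs with the product of their
laws. By the Class A condition the likelihood ratio is `∏ Q / P(q')` (`measureReal_outputs`). The
integral of its inverse over an event is at most the worst probability `r` of that event for frozen
outputs (`sum_measureReal_mul_le`), and the mean of its logarithm is the directed information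
(`directedInfo_eq_sum`). The inequality `log y ≤ y - 1` (`le_sum_log_div`) then yields `P(G) log (1
/ r) - 1 ≤ I log 2`. With `P(G) ≥ 1 - 2ε` and `r = c / |det A|^T`, dividing by `T` and passing to
the limit bounds `C` below by `(1 - 2ε) log₂ |det A|`, and `|det A|` is the product of the `|λ_i|`.
-/

/-! ### Finite entropies as expectations. -/

section FiniteInformationLemmas

variable {S X Y : Type*} [Fintype S] [Fintype X] [Fintype Y]

/-- A sum over the values of a random variable, weighted by its law, is a sum over the space. -/
lemma sum_pmfProb_mul (p : S → ℝ) (U : S → X) (g : X → ℝ) :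
    ∑ e, pmfProb p U e * g e = ∑ s, p s * g (U s) := by
  classical
  have h : ∀ e, pmfProb p U e * g e = ∑ s with U s = e, p s * g (U s) := by
    intro e
    unfold pmfProb
    rw [Finset.sum_mul]
    refine Finset.sum_congr (by congr) fun s hs => ?_
    rw [(Finset.mem_filter.1 hs).2]
  simp_rw [h]
  exact Finset.sum_fiberwise _ _ _

/-- Puts every entropy term on the common sample space, so that the terms of the directed
information can be combined pointwise. -/
lemma condEntropy_eq_sum (p : S → ℝ) (U : S → X) (V : S → Y) :
    condEntropy p U V = -∑ s, p s * Real.logb 2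
      (pmfProb p (fun s => (U s, V s)) (U s, V s) / pmfProb p V (V s)) := by
  unfold condEntropy
  rw [← sum_pmfProb_mul p (fun s => (U s, V s))
    (fun e => Real.logb 2 (pmfProb p (fun s => (U s, V s)) e / pmfProb p V e.2)),
    Fintype.sum_prod_type]

/-- The marginals of the law of `Z` are the laws of functions of `Z`. -/
lemma pmfProb_law {Ω E : Type*} [MeasurableSpace Ω] [MeasurableSpace S]
    [MeasurableSingletonClass S] (μ : Measure Ω) [IsFiniteMeasure μ] {Z : Ω → S}
    (hZ : Measurable Z) (U : S → E) (e : E) :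
    pmfProb (fun s => μ.real (Z ⁻¹' {s})) U e = μ.real {ω | U (Z ω) = e} := by
  classical
  unfold pmfProb
  rw [sum_measureReal_preimage_singleton _ fun y _ => hZ (measurableSet_singleton y)]
  congr 1
  ext ω
  simp

end FiniteInformationLemmas

lemma measurable_hist {Ω S : Type*} [MeasurableSpace Ω] [MeasurableSpace S] {y : ℕ → Ω → S} {n : ℕ}
    (h : ∀ i : Fin n, Measurable (y i)) : Measurable (hist y n) :=
  measurable_pi_lambda _ h

section ChannelLikelihood

variable {M M' : Type*} [Fintype M']

/-- The causally conditioned likelihood `∏ₜ Q(q'_t | q_{[0,t]}, q'_{[0,t-1]})`. -/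
noncomputable def channelLikelihood (Q : Channel M M') (T : ℕ)
    (z : (Fin T → M) × (Fin T → M')) : ℝ :=
  ∏ t : Fin T, (Q t (Fin.take (t + 1) t.isLt z.1) (Fin.take t t.isLt.le z.2)).1 (z.2 t)

lemma channelLikelihood_nonneg (Q : Channel M M') (T : ℕ) (z : (Fin T → M) × (Fin T → M')) :
    0 ≤ channelLikelihood Q T z :=
  Finset.prod_nonneg fun _ _ => (Q _ _ _).2.1 _

end ChannelLikelihood

/-! ### Directed information as a mean log-likelihood ratio. -/

section DirectedInformation

variable {M M' Ω : Type*} [Fintype M] [MeasurableSpace M] [DiscreteMeasurableSpace M]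
  [Fintype M'] [MeasurableSpace M'] [DiscreteMeasurableSpace M'] [MeasurableSpace Ω]

/-- Directed information as the expectation of the information density
`log₂ (∏ₜ Q(q'_t | q_{[0,t]}, q'_{[0,t-1]}) / P(q'_{[0,T-1]}))`. -/
lemma directedInfo_eq_sum (μ : Measure Ω) [IsProbabilityMeasure μ]
    (P : InputPolicy M M') (Q : Channel M M') (T : ℕ) {q : ℕ → Ω → M} {q' : ℕ → Ω → M'}
    (hq : ∀ t, Measurable (q t)) (hq' : ∀ t, Measurable (q' t))
    (hlaw : jointPMF P Q T = fun z => μ.real ((fun ω => (hist q T ω, hist q' T ω)) ⁻¹' {z}))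
    (hchan : ∀ t (a : Fin (t + 1) → M) (b : Fin t → M') (c : M'),
      μ.real {ω | q' t ω = c ∧ hist q (t + 1) ω = a ∧ hist q' t ω = b} =
        (Q t a b).1 c * μ.real {ω | hist q (t + 1) ω = a ∧ hist q' t ω = b}) :
    directedInfo P Q T = ∑ z, jointPMF P Q T z *
      Real.logb 2 (channelLikelihood Q T z / μ.real {ω | hist q' T ω = z.2}) := by
  have hZ : Measurable (fun ω => (hist q T ω, hist q' T ω)) :=
    (measurable_hist fun i => hq i).prodMk (measurable_hist fun i => hq' i)
  unfold directedInfo condMutualInfo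
  simp_rw [condEntropy_eq_sum, sub_neg_eq_add, neg_add_eq_sub, ← Finset.sum_sub_distrib, ← mul_sub]
  rw [Finset.sum_comm]
  refine Finset.sum_congr rfl fun z _ => ?_
  rw [← Finset.mul_sum]
  -- Points of mass zero contribute nothing; at the others every probability below is positive, so
  -- the logarithms split.
  by_cases hz : jointPMF P Q T z = 0
  · simp [hz]
  congr 1
  have hpos : 0 < μ.real ((fun ω => (hist q T ω, hist q' T ω)) ⁻¹' {z}) := by
    rw [hlaw] at hz
    exact measureReal_nonneg.lt_of_ne (Ne.symm hz)
  have hmono : ∀ {E : Set Ω}, (∀ ω, (hist q T ω, hist q' T ω) = z → ω ∈ E) → μ.real E ≠ 0 :=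
    fun {E} h => (hpos.trans_le (measureReal_mono fun ω hω => h ω hω)).ne'
  -- The log-probability of the first `t` outputs. The term at time `t` is `log₂ Q` minus the
  -- increment of `g`, so the output part telescopes to `g T - g 0`.
  set g : ℕ → ℝ := fun t => Real.logb 2 (μ.real {ω | ∀ i : Fin T, (i : ℕ) < t → q' i ω = z.2 i})
  have hg0 : g 0 = 0 := by simp [g]
  have hgT : g T = Real.logb 2 (μ.real {ω | hist q' T ω = z.2}) := by
    simp only [g]
    congr 3
    ext ω
    simp [hist, funext_iff]
  have hQ : ∀ t : Fin T,
      (Q t (Fin.take (t + 1) t.isLt z.1) (Fin.take t t.isLt.le z.2)).1 (z.2 t) ≠ 0 := by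
    have h : jointPMF P Q T z ≠ 0 := hz
    unfold jointPMF at h
    intro t
    exact right_ne_zero_of_mul (Finset.prod_ne_zero_iff.1 h t (Finset.mem_univ t))
  have hterm : ∀ t : Fin T, Real.logb 2
        (pmfProb (jointPMF P Q T) (fun s => (s.2 t, Fin.take (t + 1) t.isLt s.1,
            Fin.take t t.isLt.le s.2))
          (z.2 t, Fin.take (t + 1) t.isLt z.1, Fin.take t t.isLt.le z.2) /
        pmfProb (jointPMF P Q T) (fun s => (Fin.take (t + 1) t.isLt s.1, Fin.take t t.isLt.le s.2))
          (Fin.take (t + 1) t.isLt z.1, Fin.take t t.isLt.le z.2)) -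
      Real.logb 2
        (pmfProb (jointPMF P Q T) (fun s => (s.2 t, Fin.take t t.isLt.le s.2))
          (z.2 t, Fin.take t t.isLt.le z.2) /
        pmfProb (jointPMF P Q T) (fun s => Fin.take t t.isLt.le s.2)
          (Fin.take t t.isLt.le z.2)) =
      Real.logb 2 ((Q t (Fin.take (t + 1) t.isLt z.1) (Fin.take t t.isLt.le z.2)).1 (z.2 t)) -
        (g (t + 1) - g t) := by
    intro t
    rw [hlaw]
    simp_rw [pmfProb_law μ hZ]
    have h1 := hchan t (Fin.take (t + 1) t.isLt z.1) (Fin.take t t.isLt.le z.2) (z.2 t)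
    have e1 : {ω | (hist q' T ω t, Fin.take (t + 1) t.isLt (hist q T ω),
        Fin.take t t.isLt.le (hist q' T ω)) =
          (z.2 t, Fin.take (t + 1) t.isLt z.1, Fin.take t t.isLt.le z.2)} =
        {ω | q' t ω = z.2 t ∧ hist q (t + 1) ω = Fin.take (t + 1) t.isLt z.1 ∧
          hist q' t ω = Fin.take t t.isLt.le z.2} := by
      ext ω
      simp only [Set.mem_ofPred_eq, Prod.mk.injEq]
      rfl
    have e2 : {ω | (Fin.take (t + 1) t.isLt (hist q T ω),
        Fin.take t t.isLt.le (hist q' T ω)) =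
          (Fin.take (t + 1) t.isLt z.1, Fin.take t t.isLt.le z.2)} =
        {ω | hist q (t + 1) ω = Fin.take (t + 1) t.isLt z.1 ∧
          hist q' t ω = Fin.take t t.isLt.le z.2} := by
      ext ω
      simp only [Set.mem_ofPred_eq, Prod.mk.injEq]
      rfl
    have e4 : {ω | Fin.take t t.isLt.le (hist q' T ω) = Fin.take t t.isLt.le z.2} =
        {ω | ∀ i : Fin T, (i : ℕ) < t → q' i ω = z.2 i} := by
      ext ω
      simp only [Set.mem_ofPred_eq, funext_iff]
      exact ⟨fun h i hi => h ⟨i, hi⟩, fun h i => h ⟨i, i.2.trans t.2⟩ i.2⟩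
    have e3 : {ω | (hist q' T ω t, Fin.take t t.isLt.le (hist q' T ω)) =
          (z.2 t, Fin.take t t.isLt.le z.2)} =
        {ω | ∀ i : Fin T, (i : ℕ) < t + 1 → q' i ω = z.2 i} := by
      ext ω
      have h4 := Set.ext_iff.1 e4 ω
      simp only [Set.mem_ofPred_eq, Prod.mk.injEq] at h4 ⊢
      rw [h4]
      refine ⟨fun h i hi => ?_, fun h => ⟨h t (Nat.lt_succ_self _), fun i hi => h i (by omega)⟩⟩
      rcases Nat.lt_succ_iff_lt_or_eq.1 hi with h' | h'
      · exact h.2 i h'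
      · rw [Fin.ext h']
        exact h.1
    rw [e1, e2, e3, e4, h1]
    have n2 : μ.real {ω | hist q (t + 1) ω = Fin.take (t + 1) t.isLt z.1 ∧
          hist q' t ω = Fin.take t t.isLt.le z.2} ≠ 0 :=
      hmono fun ω hω => by rw [← hω]; exact ⟨rfl, rfl⟩
    have n3 : ∀ k : ℕ, μ.real {ω | ∀ i : Fin T, (i : ℕ) < k → q' i ω = z.2 i} ≠ 0 :=
      fun k => hmono fun ω hω => by rw [← hω]; exact fun i _ => rfl
    rw [mul_div_cancel_right₀ _ n2, Real.logb_div (n3 _) (n3 _)]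
  have nT : μ.real {ω | hist q' T ω = z.2} ≠ 0 := hmono fun ω hω => by rw [← hω]; rfl
  rw [channelLikelihood, Finset.sum_congr rfl fun t _ => hterm t, Finset.sum_sub_distrib,
    Fin.sum_univ_eq_sum_range (fun t => g (t + 1) - g t) T, Finset.sum_range_sub, hg0, hgT,
    Real.logb_div (Finset.prod_ne_zero_iff.2 fun t _ => hQ t) nT, sub_zero,
    Real.logb_prod _ _ fun t _ => hQ t]

/-- A change-of-measure lower bound on the mean of an information density. -/
lemma le_sum_log_div {ι : Type*} [Fintype ι] {p e K F : ι → ℝ} {r : ℝ} (hr : 0 < r)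
    (he : ∀ z, 0 ≤ e z) (hep : ∀ z, e z ≤ p z)
    (hK : ∀ z, p z ≠ 0 → 0 < K z) (hF : ∀ z, p z ≠ 0 → 0 < F z)
    (h1 : ∑ z, p z * (F z / K z) ≤ 1) (h2 : ∑ z, e z * (F z / K z) ≤ r) (hp : ∑ z, p z = 1) :
    (∑ z, e z) * Real.log (1 / r) - 1 ≤ ∑ z, p z * Real.log (K z / F z) := by
  -- With `ℓ = F / K`, apply `log y ≤ y - 1` to `ℓ` with weight `p - e` and to `ℓ / r` with weight
  -- `e`.
  have key : ∀ z, e z * Real.log (1 / r) + p z - p z * (F z / K z) -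
      (e z * (F z / K z)) / r + e z * (F z / K z) ≤ p z * Real.log (K z / F z) := by
    intro z
    by_cases hz : p z = 0
    · have : e z = 0 := le_antisymm (hz ▸ hep z) (he z)
      simp [hz, this]
    have hL : 0 < F z / K z := div_pos (hF z hz) (hK z hz)
    have hlog : Real.log (K z / F z) = -Real.log (F z / K z) := by
      rw [← Real.log_inv, inv_div]
    have i1 := Real.log_le_sub_one_of_pos hL
    have i2 := Real.log_le_sub_one_of_pos (div_pos hL hr)
    rw [Real.log_div hL.ne' hr.ne'] at i2
    rw [hlog, one_div, Real.log_inv]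
    have j1 := mul_le_mul_of_nonneg_left i1 (sub_nonneg.2 (hep z))
    have j2 := mul_le_mul_of_nonneg_left i2 (he z)
    rw [mul_div_assoc]
    linarith
  have hsum := Finset.sum_le_sum fun z (_ : z ∈ Finset.univ) => key z
  rw [Finset.sum_add_distrib, Finset.sum_sub_distrib, Finset.sum_sub_distrib,
    Finset.sum_add_distrib, ← Finset.sum_mul, ← Finset.sum_div, hp] at hsum
  have h3 : (∑ z, e z * (F z / K z)) / r ≤ 1 := (div_le_one hr).2 h2
  have h4 : 0 ≤ ∑ z, e z * (F z / K z) := by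
    refine Finset.sum_nonneg fun z _ => ?_
    by_cases hz : p z = 0
    · have : e z = 0 := le_antisymm (hz ▸ hep z) (he z)
      simp [this]
    · exact mul_nonneg (he z) (div_pos (hF z hz) (hK z hz)).le
  linarith

end DirectedInformation

/-! ### Factorization of the joint law into an input policy and the channel. -/

section CausalLaws

lemma hist_succ_eq_iff {Ω S : Type*} (y : ℕ → Ω → S) (n : ℕ) (ω : Ω) (a : Fin (n + 1) → S) :
    hist y (n + 1) ω = a ↔
      y n ω = a (Fin.last n) ∧ hist y n ω = Fin.take n n.le_succ a := by
  constructor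
  · rintro rfl
    exact ⟨rfl, rfl⟩
  · rintro ⟨h1, h2⟩
    funext i
    refine Fin.lastCases h1 (fun j => congr_fun h2 j) i

/-- If the conditional probability of `s` is constant on an event `G` of the conditioning
`σ`-algebra, then `P(s ∩ G)` is that constant times `P(G)`. -/
lemma measureReal_inter_of_condExp {Ω : Type*} {m mΩ : MeasurableSpace Ω} (hm : m ≤ mΩ) (μ : Measure Ω)
    [IsFiniteMeasure μ] {s G : Set Ω} (hs : MeasurableSet s) (hG : MeasurableSet[m] G)
    {f : Ω → ℝ} (h : μ⟦s | m⟧ =ᵐ[μ] f) {k : ℝ} (hk : ∀ ω ∈ G, f ω = k) :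
    μ.real (s ∩ G) = k * μ.real G := by
  have hi : Integrable (s.indicator fun _ => (1 : ℝ)) μ := (integrable_const 1).indicator hs
  have h1 := setIntegral_condExp hm hi hG
  rw [setIntegral_congr_ae (g := fun _ => k) (hm _ hG)
    (h.mono fun ω hω hG' => hω.trans (hk ω hG')), integral_indicator hs] at h1
  simp only [integral_const, smul_eq_mul, measureReal_restrict_apply MeasurableSet.univ,
    Set.univ_inter, mul_one, Measure.restrict_restrict hs] at h1
  rw [← h1, mul_comm]

variable {Ω : Type*} [MeasurableSpace Ω]

/-- The conditional law of a finite random variable given an event. -/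
lemma exists_condLaw {S : Type*} [Fintype S] [MeasurableSpace S] [MeasurableSingletonClass S]
    (μ : Measure Ω) [IsProbabilityMeasure μ] {Y : Ω → S} (hY : Measurable Y) (G : Set Ω) :
    ∃ p : stdSimplex ℝ S, ∀ c, μ.real {ω | Y ω = c ∧ ω ∈ G} = p.1 c * μ.real G := by
  classical
  by_cases hG : μ.real G = 0
  -- On a null event any law will do; a sample value of `Y` supplies a point mass.
  · obtain ⟨ω⟩ := μ.nonempty_of_neZero
    refine ⟨⟨_, single_mem_stdSimplex ℝ (Y ω)⟩, fun c => ?_⟩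
    rw [hG, mul_zero]
    exact le_antisymm (hG ▸ measureReal_mono fun ω hω => hω.2) measureReal_nonneg
  · have hsum : ∑ c, μ.real {ω | Y ω = c ∧ ω ∈ G} = μ.real G := by
      have := sum_measureReal_preimage_singleton (μ := μ.restrict G) (f := Y) Finset.univ
        fun c _ => hY (measurableSet_singleton c)
      simp only [measureReal_restrict_apply (hY (measurableSet_singleton _)), Finset.coe_univ,
        Set.preimage_univ, measureReal_restrict_apply MeasurableSet.univ, Set.univ_inter] at this
      exact this
    refine ⟨⟨fun c => μ.real {ω | Y ω = c ∧ ω ∈ G} / μ.real G, fun c => by positivity, ?_⟩,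
      fun c => (div_mul_cancel₀ _ hG).symm⟩
    rw [← Finset.sum_div, hsum, div_self hG]

variable {M M' : Type*} [Fintype M] [MeasurableSpace M] [DiscreteMeasurableSpace M]
  [Fintype M']

/-- The joint law of the inputs and outputs of a channel is generated by an input policy. -/
lemma exists_inputPolicy (μ : Measure Ω) [IsProbabilityMeasure μ] (Q : Channel M M')
    {q : ℕ → Ω → M} {q' : ℕ → Ω → M'} (hq : ∀ t, Measurable (q t))
    (hchan : ∀ t (a : Fin (t + 1) → M) (b : Fin t → M') (c : M'),
      μ.real {ω | q' t ω = c ∧ hist q (t + 1) ω = a ∧ hist q' t ω = b} =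
        (Q t a b).1 c * μ.real {ω | hist q (t + 1) ω = a ∧ hist q' t ω = b}) :
    ∃ P : InputPolicy M M', ∀ T, jointPMF P Q T =
      fun z => μ.real ((fun ω => (hist q T ω, hist q' T ω)) ⁻¹' {z}) := by
  -- The encoder sees the state, but capacity ranges over policies that see only past inputs and
  -- outputs. Conditioning `q_t` on that past gives such a policy with the same joint law.
  choose P hP using fun (t : ℕ) (a : Fin t → M) (b : Fin t → M') =>
    exists_condLaw μ (hq t) {ω | hist q t ω = a ∧ hist q' t ω = b}
  refine ⟨P, fun T => ?_⟩
  induction T with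
  | zero =>
    funext z
    have h : (fun ω => (hist q 0 ω, hist q' 0 ω)) ⁻¹' {z} = Set.univ :=
      Set.eq_univ_of_forall fun ω => Prod.ext (Subsingleton.elim _ _) (Subsingleton.elim _ _)
    simp [jointPMF, h]
  | succ T ih =>
    funext z
    have hstep : jointPMF P Q (T + 1) z =
        jointPMF P Q T (Fin.take T T.le_succ z.1, Fin.take T T.le_succ z.2) *
        ((P T (Fin.take T T.le_succ z.1) (Fin.take T T.le_succ z.2)).1 (z.1 (Fin.last T)) *
          (Q T z.1 (Fin.take T T.le_succ z.2)).1 (z.2 (Fin.last T))) := by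
      unfold jointPMF
      rw [Fin.prod_univ_castSucc]
      rfl
    have e1 : (fun ω => (hist q (T + 1) ω, hist q' (T + 1) ω)) ⁻¹' {z} =
        {ω | q' T ω = z.2 (Fin.last T) ∧ hist q (T + 1) ω = z.1 ∧
          hist q' T ω = Fin.take T T.le_succ z.2} := by
      ext ω
      simp only [Set.mem_preimage, Set.mem_singleton_iff, Set.mem_ofPred_eq, Prod.ext_iff,
        hist_succ_eq_iff q']
      tauto
    have e2 : {ω | hist q (T + 1) ω = z.1 ∧ hist q' T ω = Fin.take T T.le_succ z.2} =
        {ω | q T ω = z.1 (Fin.last T) ∧ ω ∈ {ω | hist q T ω = Fin.take T T.le_succ z.1 ∧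
          hist q' T ω = Fin.take T T.le_succ z.2}} := by
      ext ω
      simp only [Set.mem_ofPred_eq, hist_succ_eq_iff q]
      tauto
    have e3 : (fun ω => (hist q T ω, hist q' T ω)) ⁻¹'
          {(Fin.take T T.le_succ z.1, Fin.take T T.le_succ z.2)} =
        {ω | hist q T ω = Fin.take T T.le_succ z.1 ∧
          hist q' T ω = Fin.take T T.le_succ z.2} := by
      ext ω
      simp [Prod.ext_iff]
    rw [hstep, ih]
    simp only
    rw [e1, hchan, e2, hP, e3]
    ring

end CausalLaws

/-! ### Trajectories for frozen channel outputs. -/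

section Paths

open scoped Matrix

variable {N m : ℕ} {M M' : Type*} [MeasurableSpace M] [MeasurableSpace M']

/-- The state trajectory determined by the source `(x_0, w)` and the channel outputs `b`. -/
noncomputable def statePath (A : Matrix (Fin N) (Fin N) ℝ) (B : Matrix (Fin N) (Fin m) ℝ)
    (pol : AdmissiblePolicy N m M M') (b : ℕ → M') (X : (Fin N → ℝ) × (ℕ → Fin N → ℝ)) :
    ℕ → Fin N → ℝ
  | 0 => X.1
  | t + 1 => A *ᵥ statePath A B pol b X t + B *ᵥ pol.ctrl t (fun i => b i) + X.2 t

/-- The channel inputs determined by the source `(x_0, w)` and the channel outputs `b`. -/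
noncomputable def inputPath (A : Matrix (Fin N) (Fin N) ℝ) (B : Matrix (Fin N) (Fin m) ℝ)
    (pol : AdmissiblePolicy N m M M') (b : ℕ → M') (t : ℕ)
    (X : (Fin N → ℝ) × (ℕ → Fin N → ℝ)) : M :=
  pol.enc t (fun i => statePath A B pol b X i) (fun i => b i)

variable (A : Matrix (Fin N) (Fin N) ℝ) (B : Matrix (Fin N) (Fin m) ℝ)
    (pol : AdmissiblePolicy N m M M') (b : ℕ → M')

lemma measurable_mulVec {k l : ℕ} (A : Matrix (Fin k) (Fin l) ℝ) :
    Measurable fun v : Fin l → ℝ => A *ᵥ v :=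
  (Continuous.matrix_mulVec continuous_const continuous_id).measurable

lemma measurable_statePath (t : ℕ) : Measurable fun X => statePath A B pol b X t := by
  induction t with
  | zero => exact measurable_fst
  | succ t ih =>
    exact (((measurable_mulVec A).comp ih).add measurable_const).add
      ((measurable_pi_apply t).comp measurable_snd)

lemma measurable_inputPath (t : ℕ) : Measurable (inputPath A B pol b t) :=
  (pol.measurable_enc t).comp
    ((measurable_pi_lambda _ fun i : Fin (t + 1) => measurable_statePath A B pol b i).prodMk
      measurable_const)

/-- The state is an affine function of the initial state. -/
lemma statePath_eq_add (v : Fin N → ℝ) (w : ℕ → Fin N → ℝ) (t : ℕ) :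
    statePath A B pol b (v, w) t = (A ^ t) *ᵥ v + statePath A B pol b (0, w) t := by
  induction t with
  | zero => simp [statePath]
  | succ t ih =>
    simp only [statePath]
    rw [ih, Matrix.mulVec_add, Matrix.mulVec_mulVec, ← pow_succ']
    abel

end Paths

/-! ### Change of measure in the closed loop. -/

namespace IsClosedLoop

open scoped Matrix

variable {N m : ℕ} {M M' : Type*}
  [MeasurableSpace M] [Fintype M'] [MeasurableSpace M'] {Ω : Type*} [MeasurableSpace Ω] {μ : Measure Ω}
  {A : Matrix (Fin N) (Fin N) ℝ} {B : Matrix (Fin N) (Fin m) ℝ}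
  {ν : Measure (Fin N → ℝ)} {Q : Channel M M'}
  {pol : AdmissiblePolicy N m M M'}
  {x w : ℕ → Ω → Fin N → ℝ} {u : ℕ → Ω → Fin m → ℝ} {q : ℕ → Ω → M} {q' : ℕ → Ω → M'}

/-- The control `u_s` depends on `q'_{[0,s]}`, so agreement of the outputs strictly before `t` fixes
every control entering `x_t`. -/
lemma state_eq_statePath (h : IsClosedLoop μ A B ν Q pol x w u q q') {b : ℕ → M'} {t : ℕ} {ω : Ω}
    (hb : ∀ i < t, q' i ω = b i) : x t ω = statePath A B pol b (x 0 ω, fun s => w s ω) t := by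
  induction t with
  | zero => rfl
  | succ t ih =>
    rw [h.dynamics, h.controller, statePath, ih fun i hi => hb i (by omega)]
    have : hist q' (t + 1) ω = fun i : Fin (t + 1) => b i := funext fun i => hb i i.2
    rw [this]

lemma input_eq_inputPath (h : IsClosedLoop μ A B ν Q pol x w u q q') {b : ℕ → M'} {t : ℕ} {ω : Ω}
    (hb : ∀ i < t, q' i ω = b i) : q t ω = inputPath A B pol b t (x 0 ω, fun s => w s ω) := by
  have h1 : hist q' t ω = fun i : Fin t => b i := funext fun i => hb i i.2
  have h2 : hist x (t + 1) ω =
      fun i : Fin (t + 1) => statePath A B pol b (x 0 ω, fun s => w s ω) i :=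
    funext fun i => h.state_eq_statePath fun j hj => hb j (by omega)
  rw [h.encoder, h1, h2, inputPath]

lemma measurable_source (h : IsClosedLoop μ A B ν Q pol x w u q q') :
    Measurable fun ω => (x 0 ω, fun s : ℕ => w s ω) :=
  h.measurable_init.prodMk (measurable_pi_lambda _ h.measurable_noise)

variable [DiscreteMeasurableSpace M']

lemma measurable_state (h : IsClosedLoop μ A B ν Q pol x w u q q') (t : ℕ) :
    Measurable (x t) := by
  induction t with
  | zero => exact h.measurable_init
  | succ t ih =>
    have hu : Measurable (u t) := by
      rw [funext (h.controller t)]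
      exact (measurable_of_countable (pol.ctrl t)).comp
        (measurable_hist fun i => h.measurable_output i)
    rw [funext (h.dynamics t)]
    exact (((measurable_mulVec A).comp ih).add ((measurable_mulVec B).comp hu)).add
      (h.measurable_noise t)

lemma measurable_input (h : IsClosedLoop μ A B ν Q pol x w u q q') (t : ℕ) :
    Measurable (q t) := by
  rw [funext (h.encoder t)]
  exact (pol.measurable_enc t).comp ((measurable_hist fun i => h.measurable_state i).prodMk
    (measurable_hist fun i => h.measurable_output i))

variable [Fintype M] [DiscreteMeasurableSpace M] [IsProbabilityMeasure μ]

/-- The channel acts by `Q` even given an event of the source. -/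
lemma measureReal_output (h : IsClosedLoop μ A B ν Q pol x w u q q') (t : ℕ)
    {S : Set ((Fin N → ℝ) × (ℕ → Fin N → ℝ))} (hS : MeasurableSet S)
    (a : Fin (t + 1) → M) (b : Fin t → M') (c : M') :
    μ.real {ω | q' t ω = c ∧ (x 0 ω, fun s => w s ω) ∈ S ∧ hist q (t + 1) ω = a ∧
        hist q' t ω = b} =
      (Q t a b).1 c * μ.real {ω | (x 0 ω, fun s => w s ω) ∈ S ∧ hist q (t + 1) ω = a ∧
        hist q' t ω = b} := by
  have hm : channelSourceInfo q q' (x 0) w t ≤ ‹MeasurableSpace Ω› :=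
    ((measurable_hist fun i => h.measurable_input i).prodMk
      ((measurable_hist fun i => h.measurable_output i).prodMk h.measurable_source)).comap_le
  refine measureReal_inter_of_condExp hm μ
    (h.measurable_output t (measurableSet_singleton c)) ?_
    ((h.classA_markov t c).trans (h.channel_law t c)) ?_
  · refine ⟨{a} ×ˢ ({b} ×ˢ S), (measurableSet_singleton a).prod
      ((measurableSet_singleton b).prod hS), ?_⟩
    ext ω
    simp only [Set.mem_preimage, Set.mem_prod, Set.mem_singleton_iff]
    exact ⟨fun ⟨h1, h2, h3⟩ => ⟨h3, h1, h2⟩, fun ⟨h1, h2, h3⟩ => ⟨h2, h3, h1⟩⟩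
  · rintro ω ⟨-, h1, h2⟩
    simp only [h1, h2]

/-- The law of the outputs given the source: on each event of the source and of the input
trajectory, the outputs follow the causally conditioned likelihood. -/
lemma measureReal_outputs (h : IsClosedLoop μ A B ν Q pol x w u q q') (b : ℕ → M') (T : ℕ)
    (a : Fin T → M) {S : Set ((Fin N → ℝ) × (ℕ → Fin N → ℝ))} (hS : MeasurableSet S) :
    μ.real {ω | (x 0 ω, fun s => w s ω) ∈ S ∧ hist q T ω = a ∧ hist q' T ω = fun i : Fin T => b i} =
      channelLikelihood Q T (a, fun i => b i) * μ.real {ω | (x 0 ω, fun s => w s ω) ∈ S ∧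
        hist (fun t ω => inputPath A B pol b t (x 0 ω, fun s => w s ω)) T ω = a} := by
  -- The source event must vary: once the outputs before `T` are fixed, `q_T` is a function of the
  -- source, and the condition on `q_T` is absorbed into `S`.
  induction T generalizing S with
  | zero => simp [channelLikelihood, Subsingleton.elim _ a,
      eq_iff_true_of_subsingleton]
  | succ T ih =>
    have hstep : channelLikelihood Q (T + 1) (a, fun i => b i) =
        channelLikelihood Q T (Fin.take T T.le_succ a, fun i => b i) *
          (Q T a (fun i => b i)).1 (b T) := by
      unfold channelLikelihood
      rw [Fin.prod_univ_castSucc]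
      rfl
    have hS' : MeasurableSet (S ∩ inputPath A B pol b T ⁻¹' {a (Fin.last T)}) :=
      hS.inter (measurable_inputPath A B pol b T (measurableSet_singleton _))
    have e1 : {ω | (x 0 ω, fun s => w s ω) ∈ S ∧ hist q (T + 1) ω = a ∧
          hist q' (T + 1) ω = fun i : Fin (T + 1) => b i} =
        {ω | q' T ω = b T ∧ (x 0 ω, fun s => w s ω) ∈ S ∧ hist q (T + 1) ω = a ∧
          hist q' T ω = fun i : Fin T => b i} := by
      ext ω
      simp only [Set.mem_ofPred_eq, hist_succ_eq_iff q']
      change _ ∧ _ ∧ q' T ω = b T ∧ hist q' T ω = (fun i : Fin T => b i) ↔ _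
      tauto
    have e2 : {ω | (x 0 ω, fun s => w s ω) ∈ S ∧ hist q (T + 1) ω = a ∧
          hist q' T ω = fun i : Fin T => b i} =
        {ω | (x 0 ω, fun s => w s ω) ∈ S ∩ inputPath A B pol b T ⁻¹' {a (Fin.last T)} ∧
          hist q T ω = Fin.take T T.le_succ a ∧ hist q' T ω = fun i : Fin T => b i} := by
      ext ω
      simp only [Set.mem_ofPred_eq, hist_succ_eq_iff q, Set.mem_inter_iff, Set.mem_preimage,
        Set.mem_singleton_iff]
      have hq : hist q' T ω = (fun i : Fin T => b i) →
          q T ω = inputPath A B pol b T (x 0 ω, fun s => w s ω) :=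
        fun hb => h.input_eq_inputPath fun i hi => congr_fun hb ⟨i, hi⟩
      constructor
      · rintro ⟨h1, ⟨h2, h3⟩, h4⟩
        exact ⟨⟨h1, hq h4 ▸ h2⟩, h3, h4⟩
      · rintro ⟨⟨h1, h2⟩, h3, h4⟩
        exact ⟨h1, ⟨(hq h4).trans h2, h3⟩, h4⟩
    have e3 : {ω | (x 0 ω, fun s => w s ω) ∈ S ∩ inputPath A B pol b T ⁻¹' {a (Fin.last T)} ∧
          hist (fun t ω => inputPath A B pol b t (x 0 ω, fun s => w s ω)) T ω =
            Fin.take T T.le_succ a} =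
        {ω | (x 0 ω, fun s => w s ω) ∈ S ∧
          hist (fun t ω => inputPath A B pol b t (x 0 ω, fun s => w s ω)) (T + 1) ω = a} := by
      ext ω
      simp only [Set.mem_ofPred_eq, hist_succ_eq_iff _ T, Set.mem_inter_iff, Set.mem_preimage,
        Set.mem_singleton_iff]
      tauto
    rw [e1, h.measureReal_output T hS, e2, ih _ hS', e3, hstep]
    ring

/-- Change of measure: against the product of the laws of the source and of the outputs, an event
has at most the probability that it has for the worst fixed output sequence. -/
lemma sum_measureReal_mul_le (h : IsClosedLoop μ A B ν Q pol x w u q q') (T : ℕ)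
    {E : (ℕ → M') → Set ((Fin N → ℝ) × (ℕ → Fin N → ℝ))} (hE : ∀ b, MeasurableSet (E b))
    {G : Set Ω} (hG : ∀ b ω, (∀ i < T, q' i ω = b i) → (ω ∈ G ↔ (x 0 ω, fun s => w s ω) ∈ E b))
    {r : ℝ} (hr : ∀ b, μ.real {ω | (x 0 ω, fun s => w s ω) ∈ E b} ≤ r) :
    ∑ z : (Fin T → M) × (Fin T → M'),
      μ.real (G ∩ (fun ω => (hist q T ω, hist q' T ω)) ⁻¹' {z}) *
        (μ.real {ω | hist q' T ω = z.2} / channelLikelihood Q T z) ≤ r := by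
  -- Supplies an element of `M'` to continue a finite output word; the choice is immaterial, since
  -- membership in `G` is tested on the first `T` outputs.
  obtain ⟨ω₀⟩ := μ.nonempty_of_neZero
  have hext : ∀ b : Fin T → M', ∃ b' : ℕ → M', b = fun i : Fin T => b' i := fun b =>
    ⟨fun i => if hi : i < T then b ⟨i, hi⟩ else q' 0 ω₀, by funext i; simp⟩
  have hb : ∀ b : Fin T → M', ∑ a : Fin T → M,
      μ.real (G ∩ (fun ω => (hist q T ω, hist q' T ω)) ⁻¹' {(a, b)}) /
        channelLikelihood Q T (a, b) ≤ r := by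
    intro b
    obtain ⟨b', rfl⟩ := hext b
    have hQm : Measurable (hist (fun t ω => inputPath A B pol b' t (x 0 ω, fun s => w s ω)) T) :=
      measurable_hist fun i => (measurable_inputPath A B pol b' i).comp h.measurable_source
    have hle : ∀ a : Fin T → M,
        μ.real (G ∩ (fun ω => (hist q T ω, hist q' T ω)) ⁻¹' {(a, fun i : Fin T => b' i)}) /
          channelLikelihood Q T (a, fun i => b' i) ≤
        μ.real {ω | (x 0 ω, fun s => w s ω) ∈ E b' ∧
          hist (fun t ω => inputPath A B pol b' t (x 0 ω, fun s => w s ω)) T ω = a} := by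
      intro a
      have e : G ∩ (fun ω => (hist q T ω, hist q' T ω)) ⁻¹' {(a, fun i : Fin T => b' i)} =
          {ω | (x 0 ω, fun s => w s ω) ∈ E b' ∧ hist q T ω = a ∧
            hist q' T ω = fun i : Fin T => b' i} := by
        ext ω
        simp only [Set.mem_inter_iff, Set.mem_preimage, Set.mem_singleton_iff, Prod.mk.injEq,
          Set.mem_ofPred_eq]
        exact and_congr_left fun hω => hG b' ω fun i hi => congr_fun hω.2 ⟨i, hi⟩
      rw [e, h.measureReal_outputs b' T a (hE b')]
      -- Where the likelihood vanishes, the quotient is zero by the convention for division by zero.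
      by_cases hK : channelLikelihood Q T (a, fun i => b' i) = 0
      · rw [hK, div_zero]
        exact measureReal_nonneg
      · rw [mul_div_cancel_left₀ _ hK]
    refine (Finset.sum_le_sum fun a _ => hle a).trans ?_
    have hs := sum_measureReal_preimage_singleton
      (μ := μ.restrict {ω | (x 0 ω, fun s => w s ω) ∈ E b'}) Finset.univ
      fun a _ => hQm (measurableSet_singleton a)
    simp only [measureReal_restrict_apply (hQm (measurableSet_singleton _)), Finset.coe_univ,
      Set.preimage_univ, measureReal_restrict_apply MeasurableSet.univ, Set.univ_inter] at hs
    refine le_of_eq_of_le (Finset.sum_congr rfl fun a _ => ?_) (hs.le.trans (hr b'))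
    congr 1
    ext ω
    exact and_comm
  have hqm : Measurable (hist q' T) := measurable_hist fun i => h.measurable_output i
  have hF : ∑ b : Fin T → M', μ.real {ω | hist q' T ω = b} = 1 := by
    have := sum_measureReal_preimage_singleton (μ := μ) Finset.univ
      fun b _ => hqm (measurableSet_singleton b)
    simpa [Set.preimage] using this
  rw [Fintype.sum_prod_type_right]
  calc _ = ∑ b : Fin T → M', μ.real {ω | hist q' T ω = b} * ∑ a : Fin T → M,
        μ.real (G ∩ (fun ω => (hist q T ω, hist q' T ω)) ⁻¹' {(a, b)}) /
          channelLikelihood Q T (a, b) := by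
        refine Finset.sum_congr rfl fun b _ => ?_
        rw [Finset.mul_sum]
        exact Finset.sum_congr rfl fun a _ => by ring
    _ ≤ ∑ b : Fin T → M', μ.real {ω | hist q' T ω = b} * r :=
        Finset.sum_le_sum fun b _ => mul_le_mul_of_nonneg_left (hb b) measureReal_nonneg
    _ = r := by rw [← Finset.sum_mul, hF, one_mul]

/-- A converse bound for the directed information: an event that has probability at most `r` for
each fixed output sequence cannot be likely unless the directed information is large. -/
lemma exists_inputPolicy_directedInfo_ge (h : IsClosedLoop μ A B ν Q pol x w u q q') :
    ∃ P : InputPolicy M M', ∀ (T : ℕ) (E : (ℕ → M') → Set ((Fin N → ℝ) × (ℕ → Fin N → ℝ)))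
      (G : Set Ω) (r : ℝ), (∀ b, MeasurableSet (E b)) →
      (∀ b ω, (∀ i < T, q' i ω = b i) → (ω ∈ G ↔ (x 0 ω, fun s => w s ω) ∈ E b)) →
      (∀ b, μ.real {ω | (x 0 ω, fun s => w s ω) ∈ E b} ≤ r) → 0 < r → MeasurableSet G →
      μ.real G * Real.log (1 / r) - 1 ≤ directedInfo P Q T * Real.log 2 := by
  have hchan : ∀ t (a : Fin (t + 1) → M) (b : Fin t → M') (c : M'),
      μ.real {ω | q' t ω = c ∧ hist q (t + 1) ω = a ∧ hist q' t ω = b} =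
        (Q t a b).1 c * μ.real {ω | hist q (t + 1) ω = a ∧ hist q' t ω = b} := by
    intro t a b c
    simpa using h.measureReal_output t MeasurableSet.univ a b c
  obtain ⟨P, hP⟩ := exists_inputPolicy μ Q h.measurable_input hchan
  refine ⟨P, fun T E G r hE hG hr hr0 hGm => ?_⟩
  have hZ : Measurable (fun ω => (hist q T ω, hist q' T ω)) :=
    (measurable_hist fun i => h.measurable_input i).prodMk
      (measurable_hist fun i => h.measurable_output i)
  rw [directedInfo_eq_sum μ P Q T h.measurable_input h.measurable_output (hP T) hchan]
  have hsumG : ∑ z, μ.real (G ∩ (fun ω => (hist q T ω, hist q' T ω)) ⁻¹' {z}) = μ.real G := by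
    have hs := sum_measureReal_preimage_singleton (μ := μ.restrict G) Finset.univ
      fun z _ => hZ (measurableSet_singleton z)
    simp only [measureReal_restrict_apply (hZ (measurableSet_singleton _)), Finset.coe_univ,
      Set.preimage_univ, measureReal_restrict_apply MeasurableSet.univ, Set.univ_inter] at hs
    simpa only [Set.inter_comm G] using hs
  have hsum1 : ∑ z, jointPMF P Q T z = 1 := by
    have hs := sum_measureReal_preimage_singleton (μ := μ) Finset.univ
      fun z _ => hZ (measurableSet_singleton z)
    rw [hP T]
    simpa using hs
  have hmain := le_sum_log_div (p := jointPMF P Q T)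
    (e := fun z => μ.real (G ∩ (fun ω => (hist q T ω, hist q' T ω)) ⁻¹' {z}))
    (K := channelLikelihood Q T) (F := fun z => μ.real {ω | hist q' T ω = z.2}) hr0
    (fun z => measureReal_nonneg) (fun z => by rw [hP T]; exact measureReal_mono (by simp))
    (fun z hz => ?_) (fun z hz => ?_) ?_ (h.sum_measureReal_mul_le T hE hG hr) hsum1
  · rw [hsumG] at hmain
    refine hmain.trans (le_of_eq ?_)
    rw [Finset.sum_mul]
    refine Finset.sum_congr rfl fun z _ => ?_
    rw [mul_assoc, Real.logb, div_mul_cancel₀ _ (Real.log_pos one_lt_two).ne']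
  · refine (channelLikelihood_nonneg Q T z).lt_of_ne (Ne.symm fun h0 => hz ?_)
    unfold jointPMF
    rw [Finset.prod_mul_distrib]
    exact mul_eq_zero_of_right _ h0
  · rw [hP T] at hz
    exact (measureReal_nonneg.lt_of_ne (Ne.symm hz)).trans_le
      (measureReal_mono fun ω hω => congr_arg Prod.snd hω)
  -- The inverse likelihood ratio has total mean at most one: this is the same bound for the sure
  -- event, with `r = 1`.
  · have := h.sum_measureReal_mul_le T (E := fun _ => Set.univ) (G := Set.univ) (r := 1)
      (fun _ => MeasurableSet.univ) (by simp) (by simp)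
    rw [hP T]
    simpa using this

end IsClosedLoop

/-! ### Eigenvalues and the determinant. -/

section Determinant

/-- The norm is multiplicative. The lower bound is carried through the induction to keep the factors
nonzero, and it later gives `1 ≤ |det A|`. -/
lemma sum_logb_norm (s : Multiset ℂ) (hs : ∀ z ∈ s, 1 ≤ ‖z‖) :
    (s.map fun z => Real.logb 2 ‖z‖).sum = Real.logb 2 ‖s.prod‖ ∧ 1 ≤ ‖s.prod‖ := by
  induction s using Multiset.induction_on with
  | empty => simp
  | cons a s ih =>
    obtain ⟨h1, h2⟩ := ih fun z hz => hs z (Multiset.mem_cons_of_mem hz)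
    have ha := hs a (Multiset.mem_cons_self a s)
    rw [Multiset.map_cons, Multiset.sum_cons, Multiset.prod_cons, norm_mul, h1,
      Real.logb_mul (by positivity) (by positivity)]
    exact ⟨rfl, one_le_mul_of_one_le_of_one_le ha h2⟩

/-- Over `ℂ` the characteristic polynomial splits, so the determinant is the product of its roots.
-/
lemma norm_prod_aroots_charpoly {N : ℕ} (A : Matrix (Fin N) (Fin N) ℝ) :
    ‖(A.charpoly.aroots ℂ).prod‖ = |A.det| := by
  rw [Polynomial.aroots, ← Matrix.charpoly_map, ← Matrix.det_eq_prod_roots_charpoly,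
    ← RingHom.mapMatrix_apply, ← RingHom.map_det]
  simp

end Determinant

/-! ### Recurrence to bounded sets from asymptotic mean stationarity. -/

section Tightness

/-- A probability measure is nearly concentrated on a member of an increasing sequence of events
that exhausts the space up to a null set. -/
lemma exists_lt_measureReal_of_monotone {α : Type*} [MeasurableSpace α] (P : Measure α)
    [IsProbabilityMeasure P] {s : ℕ → Set α} (hs : Monotone s) (h : ∀ᵐ a ∂P, ∃ n, a ∈ s n)
    {ε : ℝ} (hε : 0 < ε) : ∃ n, 1 - ε < P.real (s n) := by
  have h1 : P (⋃ n, s n) = 1 := by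
    have hu : ⋃ n, s n =ᵐ[P] Set.univ :=
      eventuallyEq_univ.2 (h.mono fun a ha => Set.mem_iUnion.2 ha)
    rw [measure_congr hu, measure_univ]
  have h2 : Tendsto (fun n => P.real (s n)) atTop (𝓝 1) := by
    have := (ENNReal.tendsto_toReal (h1 ▸ ENNReal.one_ne_top : P (⋃ n, s n) ≠ ⊤)).comp
      (tendsto_measure_iUnion_atTop hs)
    rw [h1] at this
    exact this
  exact (h2.eventually (lt_mem_nhds (by linarith))).exists

/-- An asymptotically mean stationary process visits some bounded set with probability close to
one at arbitrarily late times. -/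
lemma IsAMS.exists_frequently {N : ℕ} {P : Measure (ℕ → Fin N → ℝ)} (h : IsAMS P)
    {ε : ℝ} (hε : 0 < ε) : ∃ R : ℝ, 0 < R ∧
      ∃ᶠ T in atTop, 1 - ε < P.real {z | z T ∈ Metric.closedBall 0 R} := by
  obtain ⟨Pbar, hPbar, hlim⟩ := h
  obtain ⟨n, hn⟩ := exists_lt_measureReal_of_monotone Pbar
    (s := fun n : ℕ => {z : ℕ → Fin N → ℝ | z 0 ∈ Metric.closedBall 0 ((n : ℝ) + 1)})
    (fun i j hij z hz => Metric.closedBall_subset_closedBall (by gcongr) hz)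
    (ae_of_all _ fun z => by
      obtain ⟨n, hn⟩ := exists_nat_ge ‖z 0‖
      exact ⟨n, mem_closedBall_zero_iff.2 (by linarith)⟩) hε
  refine ⟨n + 1, by positivity, fun hev => ?_⟩
  have hmeas : MeasurableSet {z : ℕ → Fin N → ℝ | z 0 ∈ Metric.closedBall 0 ((n : ℝ) + 1)} :=
    measurable_pi_apply 0 Metric.isClosed_closedBall.measurableSet
  have hpre : ∀ k, seqShift^[k] ⁻¹' {z : ℕ → Fin N → ℝ | z 0 ∈ Metric.closedBall 0 ((n : ℝ) + 1)} =
      {z | z k ∈ Metric.closedBall 0 ((n : ℝ) + 1)} := by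
    intro k
    have hsh : ∀ (k i : ℕ) (z : ℕ → Fin N → ℝ), seqShift^[k] z i = z (i + k) := by
      intro k
      induction k with
      | zero => intro i z; rfl
      | succ k ih =>
        intro i z
        rw [Function.iterate_succ_apply, ih, seqShift, add_assoc]
    ext z
    simp [hsh]
  have hl := hlim _ hmeas
  simp_rw [hpre] at hl
  obtain ⟨T₀, hT₀⟩ := eventually_atTop.1 hev
  -- If the visits failed from `T₀` on, the probabilities would be dominated by a sequence
  -- eventually equal to `1 - ε`. Its Cesàro means tend to `1 - ε`, contradicting that the
  -- stationary mean gives the ball more.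
  have hbound : ∀ k, P.real {z | z k ∈ Metric.closedBall 0 ((n : ℝ) + 1)} ≤
      (1 - ε) + if k < T₀ then
        |P.real {z | z k ∈ Metric.closedBall 0 ((n : ℝ) + 1)} - (1 - ε)| else 0 := by
    intro k
    split_ifs with hk
    · linarith [le_abs_self (P.real {z | z k ∈ Metric.closedBall 0 ((n : ℝ) + 1)} - (1 - ε))]
    · linarith [not_lt.1 (hT₀ k (not_lt.1 hk))]
  have hz : Tendsto (fun k => (1 - ε) + if k < T₀ then
        |P.real {z | z k ∈ Metric.closedBall 0 ((n : ℝ) + 1)} - (1 - ε)| else 0)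
      atTop (𝓝 (1 - ε)) := by
    refine tendsto_const_nhds.congr' ?_
    filter_upwards [eventually_ge_atTop T₀] with k hk
    simp [not_lt.2 hk]
  refine hn.not_ge (le_of_tendsto_of_tendsto' hl hz.cesaro fun k => ?_)
  rw [one_div]
  gcongr with i
  exact hbound i

end Tightness

/-! ### Volume growth and the capacity bound. -/

namespace IsClosedLoop

open scoped Matrix

variable {N m : ℕ} {M M' : Type*}
  [MeasurableSpace M] [Fintype M'] [MeasurableSpace M']
  {Ω : Type*} [MeasurableSpace Ω] {μ : Measure Ω} [IsProbabilityMeasure μ]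
  {A : Matrix (Fin N) (Fin N) ℝ} {B : Matrix (Fin N) (Fin m) ℝ}
  {ν : Measure (Fin N → ℝ)} {Q : Channel M M'}
  {pol : AdmissiblePolicy N m M M'}
  {x w : ℕ → Ω → Fin N → ℝ} {u : ℕ → Ω → Fin m → ℝ} {q : ℕ → Ω → M} {q' : ℕ → Ω → M'}

/-- For a fixed output sequence, the state is in a given set `K` with probability at most
proportional to `vol K / |det A| ^ T`, on the event that the density of `x_0` is bounded. -/
lemma measureReal_statePath_le (h : IsClosedLoop μ A B ν Q pol x w u q q')
    (hac : μ.map (x 0) ≪ volume) (hdet : A.det ≠ 0) (L : NNReal) {K : Set (Fin N → ℝ)}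
    (hK : MeasurableSet K) (hK' : volume K ≠ ⊤) (T : ℕ) (b : ℕ → M') :
    μ.real {ω | (x 0 ω, fun s => w s ω) ∈ {X : (Fin N → ℝ) × (ℕ → Fin N → ℝ) |
        X.1 ∈ {v | (μ.map (x 0)).rnDeriv volume v ≤ L} ∧ statePath A B pol b X T ∈ K}} ≤
      L * volume.real K / |A.det| ^ T := by
  have hX := h.measurable_source
  have : IsProbabilityMeasure (μ.map (x 0)) :=
    Measure.isProbabilityMeasure_map h.measurable_init.aemeasurable
  have hW : Measurable fun ω => fun s : ℕ => w s ω := measurable_pi_lambda _ h.measurable_noise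
  have : IsProbabilityMeasure (μ.map fun ω => fun s : ℕ => w s ω) :=
    Measure.isProbabilityMeasure_map hW.aemeasurable
  set D : Set (Fin N → ℝ) := {v | (μ.map (x 0)).rnDeriv volume v ≤ L} with hD
  have hDm : MeasurableSet D := measurableSet_le (Measure.measurable_rnDeriv _ _) measurable_const
  set S : Set ((Fin N → ℝ) × (ℕ → Fin N → ℝ)) :=
    {X | X.1 ∈ D ∧ statePath A B pol b X T ∈ K} with hS
  have hSm : MeasurableSet S :=
    (measurable_fst hDm).inter (measurable_statePath A B pol b T hK)
  have hdT : LinearMap.det (Matrix.toLin' (A ^ T)) ≠ 0 := by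
    rw [LinearMap.det_toLin', Matrix.det_pow]
    exact pow_ne_zero _ hdet
  -- For fixed noise the state is affine in `x_0` with linear part `A^T`, so the preimage of `K` has
  -- volume `vol(K) / |det A|^T`, and the density is at most `L` on `D`. Independence of `x_0` and
  -- the noise then allows averaging over the slices.
  have hslice : ∀ v : ℕ → Fin N → ℝ, μ.map (x 0) ((fun y => (y, v)) ⁻¹' S) ≤
      L * (ENNReal.ofReal |(A.det ^ T)⁻¹| * volume K) := by
    intro v
    set c := statePath A B pol b (0, v) T
    have e : (fun y => (y, v)) ⁻¹' S =
        D ∩ Matrix.toLin' (A ^ T) ⁻¹' ((fun y => y + c) ⁻¹' K) := by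
      ext y
      simp only [hS, Set.mem_preimage, Set.mem_ofPred_eq, Set.mem_inter_iff,
        statePath_eq_add A B pol b y, Matrix.toLin'_apply, c]
    have hSv : MeasurableSet ((fun y => (y, v)) ⁻¹' S) := measurable_prodMk_right hSm
    calc μ.map (x 0) ((fun y => (y, v)) ⁻¹' S)
        = ∫⁻ y in (fun y => (y, v)) ⁻¹' S, (μ.map (x 0)).rnDeriv volume y :=
          (Measure.setLIntegral_rnDeriv hac _).symm
      _ ≤ ∫⁻ _ in (fun y => (y, v)) ⁻¹' S, (L : ENNReal) :=
          setLIntegral_mono measurable_const fun y hy => hy.1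
      _ = L * volume ((fun y => (y, v)) ⁻¹' S) := setLIntegral_const _ _
      _ ≤ L * volume (Matrix.toLin' (A ^ T) ⁻¹' ((fun y => y + c) ⁻¹' K)) := by
          rw [e]
          gcongr
          exact Set.inter_subset_right
      _ = _ := by
          rw [Measure.addHaar_preimage_linearMap _ hdT, measure_preimage_add_right,
            LinearMap.det_toLin', Matrix.det_pow]
  have hprod : μ.map (fun ω => (x 0 ω, fun s : ℕ => w s ω)) =
      (μ.map (x 0)).prod (μ.map fun ω => fun s : ℕ => w s ω) :=
    (indepFun_iff_map_prod_eq_prod_map_map h.measurable_init.aemeasurable hW.aemeasurable).1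
      h.init_indep
  have hmain : μ {ω | (x 0 ω, fun s => w s ω) ∈ S} ≤
      L * (ENNReal.ofReal |(A.det ^ T)⁻¹| * volume K) := by
    change μ ((fun ω => (x 0 ω, fun s : ℕ => w s ω)) ⁻¹' S) ≤ _
    rw [← Measure.map_apply hX hSm, hprod, Measure.prod_apply_symm hSm]
    refine (lintegral_mono hslice).trans ?_
    simp
  refine (ENNReal.toReal_mono (by finiteness) hmain).trans (le_of_eq ?_)
  rw [ENNReal.toReal_mul, ENNReal.toReal_mul, ENNReal.toReal_ofReal (abs_nonneg _), abs_inv,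
    abs_pow, ENNReal.coe_toReal, Measure.real]
  ring

variable [Fintype M] [DiscreteMeasurableSpace M] [DiscreteMeasurableSpace M']

/-- The capacity bound up to `ε`. -/
lemma mul_log_det_le (h : IsClosedLoop μ A B ν Q pol x w u q q') {C : ℝ}
    (hC : HasFeedbackCapacity Q C) (hac : μ.map (x 0) ≪ volume)
    (hAMS : IsAMS (μ.map (fun ω => fun t : ℕ => x t ω))) (hdet : 1 ≤ |A.det|)
    {ε : ℝ} (hε : 0 < ε) : (1 - 2 * ε) * Real.log |A.det| ≤ C * Real.log 2 := by
  obtain ⟨P, hP⟩ := h.exists_inputPolicy_directedInfo_ge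
  obtain ⟨Rate, hRate, hlim⟩ := hC
  obtain ⟨R, hR, hfreq⟩ := hAMS.exists_frequently hε
  have hxm : Measurable fun ω => fun t : ℕ => x t ω := measurable_pi_lambda _ h.measurable_state
  have : IsProbabilityMeasure (μ.map (x 0)) :=
    Measure.isProbabilityMeasure_map h.measurable_init.aemeasurable
  have hdet0 : A.det ≠ 0 := abs_pos.1 (one_pos.trans_le hdet)
  set K : Set (Fin N → ℝ) := Metric.closedBall 0 R
  have hKm : MeasurableSet K := Metric.isClosed_closedBall.measurableSet
  have hK' : volume K ≠ ⊤ := (isCompact_closedBall _ _).measure_lt_top.ne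
  have hK0 : 0 < volume.real K :=
    ENNReal.toReal_pos (Metric.measure_closedBall_pos volume 0 hR).ne' hK'
  -- The density is finite almost everywhere, so its sublevel sets exhaust the space. The level `n +
  -- 1` is positive, which makes the constant `c` below positive.
  obtain ⟨n, hn⟩ := exists_lt_measureReal_of_monotone (μ.map (x 0))
    (s := fun n : ℕ => {v | (μ.map (x 0)).rnDeriv volume v ≤ (n + 1 : ℕ)})
    (fun i j hij v hv => le_trans (Set.mem_ofPred_eq ▸ hv) (by gcongr))
    (hac.ae_le ((Measure.rnDeriv_lt_top _ _).mono fun v hv => by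
      obtain ⟨n, hn⟩ := ENNReal.exists_nat_gt hv.ne
      exact ⟨n, hn.le.trans (by gcongr; exact n.le_succ)⟩)) hε
  set D : Set (Fin N → ℝ) := {v | (μ.map (x 0)).rnDeriv volume v ≤ ((n + 1 : ℕ) : NNReal)} with hD
  have hDm : MeasurableSet D := measurableSet_le (Measure.measurable_rnDeriv _ _) measurable_const
  have hn' : 1 - ε < μ.real (x 0 ⁻¹' D) := by
    rw [← map_measureReal_apply h.measurable_init hDm]
    simpa [hD] using hn
  set c : ℝ := ((n + 1 : ℕ) : NNReal) * volume.real K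
  have hc : 0 < c := mul_pos (by positivity) hK0
  -- Only infinitely many `T` are available, which suffices because the rates converge to `C`.
  have hfreq' : ∃ᶠ T : ℕ in atTop, (1 - 2 * ε) * Real.log |A.det| ≤
      Rate T * Real.log 2 + (|Real.log c| + 1) / T := by
    refine (hfreq.and_eventually (eventually_gt_atTop 0)).mono ?_
    rintro T ⟨hT, hT0⟩
    have hT' : 1 - ε < μ.real (x T ⁻¹' K) := by
      have hm := map_measureReal_apply (μ := μ) hxm (measurable_pi_apply T hKm)
      exact hT.trans_eq hm
    have hG : 1 - 2 * ε ≤ μ.real (x 0 ⁻¹' D ∩ x T ⁻¹' K) := by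
      have h1 := measureReal_union_add_inter (μ := μ) (s := x 0 ⁻¹' D)
        (h.measurable_state T hKm)
      have h2 : μ.real (x 0 ⁻¹' D ∪ x T ⁻¹' K) ≤ 1 := measureReal_le_one
      linarith
    have hdetT : 0 < |A.det| ^ T := by positivity
    have hinfo := hP T (fun b => {X | X.1 ∈ D ∧ statePath A B pol b X T ∈ K})
      (x 0 ⁻¹' D ∩ x T ⁻¹' K) (c / |A.det| ^ T)
      (fun b => (measurable_fst hDm).inter (measurable_statePath A B pol b T hKm))
      (fun b ω hb => by
        simp only [Set.mem_inter_iff, Set.mem_preimage, Set.mem_ofPred_eq,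
          h.state_eq_statePath hb])
      (fun b => h.measureReal_statePath_le hac hdet0 _ hKm hK' T b) (div_pos hc hdetT)
      ((h.measurable_init hDm).inter (h.measurable_state T hKm))
    -- The single policy `P` serves every horizon, and `Rate T` is the maximum over all policies.
    have hrate : (1 / (T : ℝ)) * directedInfo P Q T ≤ Rate T := (hRate T).2 ⟨P, rfl⟩
    have hTpos : (0 : ℝ) < T := Nat.cast_pos.2 hT0
    have hlog2 : 0 < Real.log 2 := Real.log_pos one_lt_two
    have hl : 0 ≤ Real.log |A.det| := Real.log_nonneg hdet
    rw [one_div_div, Real.log_div hdetT.ne' hc.ne', Real.log_pow, mul_sub] at hinfo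
    have h1 : (1 - 2 * ε) * (T * Real.log |A.det|) ≤
        μ.real (x 0 ⁻¹' D ∩ x T ⁻¹' K) * (T * Real.log |A.det|) :=
      mul_le_mul_of_nonneg_right hG (by positivity)
    have h2 : μ.real (x 0 ⁻¹' D ∩ x T ⁻¹' K) * Real.log c ≤ |Real.log c| :=
      (mul_le_mul_of_nonneg_left (le_abs_self _) measureReal_nonneg).trans
        (mul_le_of_le_one_left (abs_nonneg _) measureReal_le_one)
    have h3 : directedInfo P Q T ≤ T * Rate T := by
      rwa [one_div, inv_mul_le_iff₀ hTpos] at hrate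
    have h4 := mul_le_mul_of_nonneg_right h3 hlog2.le
    refine le_of_mul_le_mul_left ?_ hTpos
    rw [mul_add, mul_div_cancel₀ _ hTpos.ne']
    linarith
  have hlim' : Tendsto (fun T : ℕ => Rate T * Real.log 2 + (|Real.log c| + 1) / T) atTop
      (𝓝 (C * Real.log 2 + 0)) :=
    (hlim.mul_const _).add (tendsto_const_div_atTop_nhds_zero_nat _)
  rw [add_zero] at hlim'
  exact ge_of_tendsto_of_frequently hlim' hfreq'

end IsClosedLoop

theorem mainTheorem8
    {N m : ℕ} {M M' : Type*}
    [Fintype M] [MeasurableSpace M] [DiscreteMeasurableSpace M]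
    [Fintype M'] [MeasurableSpace M'] [DiscreteMeasurableSpace M']
    {Ω : Type*} [MeasurableSpace Ω] (μ : Measure Ω) [IsProbabilityMeasure μ]
    (A : Matrix (Fin N) (Fin N) ℝ) (B : Matrix (Fin N) (Fin m) ℝ)
    (hA : ∀ z ∈ A.charpoly.aroots ℂ, 1 ≤ ‖z‖)
    (ν : Measure (Fin N → ℝ))
    (Q : Channel M M') (C : ℝ) (hC : HasFeedbackCapacity Q C)
    (pol : AdmissiblePolicy N m M M')
    (x w : ℕ → Ω → Fin N → ℝ) (u : ℕ → Ω → Fin m → ℝ) (q : ℕ → Ω → M) (q' : ℕ → Ω → M')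
    (hloop : IsClosedLoop μ A B ν Q pol x w u q q')
    (hent : HasDiffEntropy (μ.map (x 0))) (hfin : diffEntropy (μ.map (x 0)) < ⊤)
    (hAMS : IsAMS (μ.map (fun ω => fun t : ℕ => x t ω))) :
    ((A.charpoly.aroots ℂ).map (fun z => Real.logb 2 ‖z‖)).sum ≤ C := by
  obtain ⟨hsum, hdet⟩ := sum_logb_norm _ hA
  rw [norm_prod_aroots_charpoly] at hsum hdet
  rw [hsum, Real.logb, div_le_iff₀ (Real.log_pos one_lt_two)]
  have hl : 0 ≤ Real.log |A.det| := Real.log_nonneg hdet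
  refine le_of_forall_pos_le_add fun δ hδ => ?_
  have hpos : 0 < 2 * (Real.log |A.det| + 1) := by positivity
  -- Chosen so that the loss `2ε log |det A|` is at most `δ`; the added `1` keeps the denominator
  -- positive when `|det A| = 1`.
  have h := hloop.mul_log_det_le hC hent.1 hAMS hdet (ε := δ / (2 * (Real.log |A.det| + 1)))
    (div_pos hδ hpos)
  have h1 : 2 * (δ / (2 * (Real.log |A.det| + 1))) * (Real.log |A.det| + 1) = δ := by
    field_simp
  have h2 : 0 < δ / (2 * (Real.log |A.det| + 1)) := div_pos hδ hpos
  linarith
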